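/- Let $k$ be an algebraically closed field and let $S$ be an algebraic semigroup over $k$, that is, an algebraic variety over $k$ (a reduced, separated scheme of finite type over $k$, not necessarily irreducible) equipped with an associative morphism $S\times S\to S$; by points of $S$ we mean $k$-rational points, so that these form an abstract semigroup. For an idempotent $e$ of $S$, let $H_e$ denote the group of units of the monoid $eSe$ (with neutral element $e$). Then for every $x\in S$ there is a unique idempotent $e(x)\in S$ such that $x^m\in H_{e(x)}$ for some $m>0$. Moreover, there exists an integer $n>0$, depending only on $S$, such that $x^n\in H_{e(x)}$ for all $x\in S$. Finally, $S$ is the union of finitely many pairwise disjoint locally closed subsets $U_j$ such that, each $U_j$ being equipped with its reduced subscheme structure, the restriction of the map $e:x\mapsto e(x)$ to each $U_j$ is a morphism $U_j\to S$ over $k$. -/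

import Mathlib

open CategoryTheory MonoidalCategory CartesianMonoidalCategory AlgebraicGeometry

universe u v w

/-- A semigroup object in a cartesian monoidal category: an object `S` with an associative
multiplication `S ⊗ S ⟶ S` (no unit is required). -/
class SemigroupObj {C : Type w} [Category.{v} C] [CartesianMonoidalCategory C] (S : C) where
  /-- The multiplication morphism. -/
  mul : S ⊗ S ⟶ S
  mul_assoc : (mul ▷ S) ≫ mul = (α_ S S S).hom ≫ (S ◁ mul) ≫ mul

namespace SemigroupObj

/-- The set of `T`-points of a semigroup object is a semigroup under pointwise multiplication. -/
instance homSemigroup {C : Type w} [Category.{v} C] [CartesianMonoidalCategory C] (T S : C)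
    [SemigroupObj S] : Semigroup (T ⟶ S) where
  mul x y := lift x y ≫ mul
  mul_assoc x y z := by
    change lift (lift x y ≫ mul) z ≫ mul = lift x (lift y z ≫ mul) ≫ mul
    have h := congrArg (fun f => lift (lift x y) z ≫ f) (mul_assoc (S := S))
    simpa using h

end SemigroupObj

/-- The power `x ^ n`, `n > 0`, of an element of a semigroup. -/
def semigroupPow {M : Type w} [Semigroup M] (x : M) (n : ℕ+) : M :=
  PNat.recOn n x (fun _ y => y * x)

/-- For an idempotent `e`, the unit group `H_e` of the monoid `e M e` (with neutral element `e`),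
as a subset of the semigroup `M`. -/
def cornerUnits {M : Type w} [Semigroup M] (e : M) : Set M :=
  {a | a ∈ Subsemigroup.corner e ∧ ∃ b ∈ Subsemigroup.corner e, a * b = e ∧ b * a = e}

/-- `e` is an idempotent such that some positive power of `x` is a unit of `e M e`. -/
def IsAttachedIdempotent {M : Type w} [Semigroup M] (x e : M) : Prop :=
  IsIdempotentElem e ∧ ∃ n : ℕ+, semigroupPow x n ∈ cornerUnits e

section Varieties

variable {k : Type u} [Field k]

/-- The set `S(k)` of `k`-rational points of a `k`-scheme `S`, i.e. the set of `k`-morphisms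
`Spec k ⟶ S`. -/
abbrev RatPoints (S : Over (Spec (.of k))) : Type u :=
  𝟙_ (Over (Spec (.of k))) ⟶ S

/-- The restriction to the locally closed subset `U` of the map `f : S(k) → S'(k)` is a morphism:
if `i : V ⟶ S` is `U` with its reduced induced subscheme structure, then there is a `k`-morphism
`g : V ⟶ S'` which agrees with `f` on `k`-rational points. -/
def IsMorphismOn {S S' : Over (Spec (.of k))} (U : Set S.left) (f : RatPoints S → RatPoints S') :
    Prop :=
  ∃ (V : Over (Spec (.of k))) (i : V ⟶ S) (g : V ⟶ S'),
    IsReduced V.left ∧ IsImmersion i.left ∧ Set.range i.left = U ∧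
      ∀ p : RatPoints V, p ≫ g = f (p ≫ i)

end Varieties

/-! ### Powers and group inverses in semigroups -/

section Semigroup

variable {M : Type w} [Semigroup M]

/-! An idempotent attached to `x` amounts to a group inverse `y` of some power `x ^ n`, with `e(x) =
x ^ n * y`. This condition is equational and has at most one solution `y` in any semigroup
(`IsGroupInverse.unique`), so it can be imposed on points with values in any scheme, pulled back,
and descended.

For a rational point, the closures of the tails `{x ^ n | n ≥ m}` stabilise. Let `D` be the closure
of the pairs `(x ^ a, x ^ b)` with large exponents. The shearing map `(u, v) ↦ (u, u * v)` has dense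
image in `D`, constructible by Chevalley, so it meets the dense set of pairs with `a > b`. This
solves `x ^ a * z = x ^ b`, and `z`, a formal negative power of `x`, yields the group inverse
(`exists_isGroupInverse_semigroupPow`).

Base change and faithfully flat descent extend this to points over every field extension of `k`, in
particular to the generic point of each integral closed subscheme. There the inverse spreads out to
an open subset, where a single exponent works and `e` is the morphism `i ^ n * y`. Noetherian
induction leaves finitely many such strata, and the product of their exponents serves for all of
`S`. -/

lemma semigroupPow_one (x : M) : semigroupPow x 1 = x := rfl

lemma semigroupPow_succ (x : M) (n : ℕ+) : semigroupPow x (n + 1) = semigroupPow x n * x :=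
  PNat.recOn_succ _ _ _

/-- Reduces identities between positive powers to those in a monoid. -/
lemma coe_semigroupPow (x : M) (n : ℕ+) :
    ((semigroupPow x n : M) : WithOne M) = (x : WithOne M) ^ (n : ℕ) := by
  induction n with
  | one => simp [semigroupPow_one]
  | succ n ih => rw [semigroupPow_succ, WithOne.coe_mul, ih, PNat.add_coe, PNat.one_coe, pow_succ]

lemma semigroupPow_add (x : M) (m n : ℕ+) :
    semigroupPow x (m + n) = semigroupPow x m * semigroupPow x n := by
  apply WithOne.coe_injective
  rw [WithOne.coe_mul, coe_semigroupPow, coe_semigroupPow, coe_semigroupPow, PNat.add_coe, pow_add]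

lemma semigroupPow_mul (x : M) (m n : ℕ+) :
    semigroupPow x (m * n) = semigroupPow (semigroupPow x m) n := by
  apply WithOne.coe_injective
  rw [coe_semigroupPow, coe_semigroupPow, coe_semigroupPow, PNat.mul_coe, pow_mul]

lemma Commute.mul_semigroupPow {x y : M} (h : Commute x y) (n : ℕ+) :
    semigroupPow (x * y) n = semigroupPow x n * semigroupPow y n := by
  have h' : Commute (x : WithOne M) y := by
    rw [Commute, SemiconjBy, ← WithOne.coe_mul, ← WithOne.coe_mul, h.eq]
  apply WithOne.coe_injective
  rw [WithOne.coe_mul, coe_semigroupPow, coe_semigroupPow, coe_semigroupPow, WithOne.coe_mul,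
    h'.mul_pow]

lemma Commute.semigroupPow_right {x y : M} (h : Commute x y) (n : ℕ+) :
    Commute x (semigroupPow y n) := by
  induction n with
  | one => exact h
  | succ n ih => rw [semigroupPow_succ]; exact ih.mul_right h

lemma Commute.semigroupPow_semigroupPow {x y : M} (h : Commute x y) (m n : ℕ+) :
    Commute (semigroupPow x m) (semigroupPow y n) :=
  ((h.semigroupPow_right n).symm.semigroupPow_right m).symm

lemma IsIdempotentElem.semigroupPow_eq {e : M} (h : IsIdempotentElem e) (n : ℕ+) :
    semigroupPow e n = e := by
  induction n with
  | one => rfl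
  | succ n ih => rw [semigroupPow_succ, ih, h.eq]

lemma map_semigroupPow {N : Type*} [Semigroup N] (φ : M →ₙ* N) (x : M) (n : ℕ+) :
    φ (semigroupPow x n) = semigroupPow (φ x) n := by
  induction n with
  | one => rfl
  | succ n ih => rw [semigroupPow_succ, semigroupPow_succ, map_mul, ih]

/-- `y` is the group inverse of `p`: the two elements are inverse to each other in the group of
units of a corner of the semigroup, namely the one at the idempotent `p * y`. -/
structure IsGroupInverse (p y : M) : Prop where
  comm : p * y = y * p
  mul_mul_left : p * y * p = p
  mul_mul_right : y * p * y = y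

namespace IsGroupInverse

variable {p y z : M}

lemma isIdempotentElem (h : IsGroupInverse p y) : IsIdempotentElem (p * y) := by
  rw [IsIdempotentElem, ← mul_assoc, h.mul_mul_left]

lemma mem_cornerUnits (h : IsGroupInverse p y) : p ∈ cornerUnits (p * y) := by
  refine ⟨?_, y, ?_, rfl, h.comm.symm⟩ <;> rw [Subsemigroup.mem_corner_iff h.isIdempotentElem]
  · exact ⟨h.mul_mul_left, by rw [h.comm, ← mul_assoc, h.mul_mul_left]⟩
  · exact ⟨by rw [h.comm, h.mul_mul_right], by rw [← mul_assoc, h.mul_mul_right]⟩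

lemma of_cornerUnits {e : M} (he : IsIdempotentElem e) (hp : p ∈ cornerUnits e) :
    ∃ y, IsGroupInverse p y ∧ p * y = e := by
  obtain ⟨hp, y, hy, h₁, h₂⟩ := hp
  rw [Subsemigroup.mem_corner_iff he] at hp hy
  exact ⟨y, ⟨h₁.trans h₂.symm, by rw [h₁, hp.1], by rw [h₂, hy.1]⟩, h₁⟩

/-- Both `y` and `z` reduce to `p * z * y`. No idempotent is fixed in advance, so this gives
uniqueness of `e(x)` as well as the descent datum over field extensions. -/
protected lemma unique (h : IsGroupInverse p y) (h' : IsGroupInverse p z) : y = z := by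
  calc y = y * (p * y) := by rw [← mul_assoc, h.mul_mul_right]
    _ = y * (p * z * p * y) := by rw [h'.mul_mul_left]
    _ = y * p * (z * p) * y := by simp only [mul_assoc]
    _ = y * p * (p * z) * y := by rw [h'.comm]
    _ = p * y * p * z * y := by rw [h.comm]; simp only [mul_assoc]
    _ = p * z * y := by rw [h.mul_mul_left]
    _ = z * (p * y) := by rw [h'.comm, mul_assoc]
    _ = z * p * z * (p * y) := by rw [h'.mul_mul_right]
    _ = z * (p * z) * (p * y) := by simp only [mul_assoc]
    _ = z * (z * (p * y * p)) := by rw [h'.comm, h.comm, mul_assoc, mul_assoc, ← mul_assoc p,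
                                      ← h.comm]
    _ = z := by rw [h.mul_mul_left, ← h'.comm, ← mul_assoc, h'.mul_mul_right]

lemma semigroupPow (h : IsGroupInverse p y) (n : ℕ+) :
    IsGroupInverse (semigroupPow p n) (semigroupPow y n) ∧
      _root_.semigroupPow p n * _root_.semigroupPow y n = p * y := by
  have hc : Commute p y := h.comm
  have hc' : Commute (p * y) p := (Commute.refl p).mul_left hc.symm
  have hc'' : Commute (p * y) y := hc.mul_left (Commute.refl y)
  have key : _root_.semigroupPow p n * _root_.semigroupPow y n = p * y := by
    rw [← hc.mul_semigroupPow, h.isIdempotentElem.semigroupPow_eq]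
  refine ⟨⟨hc.semigroupPow_semigroupPow n n, ?_, ?_⟩, key⟩
  · rw [key]
    nth_rw 1 [← h.isIdempotentElem.semigroupPow_eq n]
    rw [← hc'.mul_semigroupPow, h.mul_mul_left]
  · rw [← (hc.semigroupPow_semigroupPow n n).eq, key]
    nth_rw 1 [← h.isIdempotentElem.semigroupPow_eq n]
    rw [← hc''.mul_semigroupPow, h.comm, h.mul_mul_right]

lemma map {N : Type*} [Semigroup N] (φ : M →ₙ* N) (h : IsGroupInverse p y) :
    IsGroupInverse (φ p) (φ y) :=
  ⟨by rw [← map_mul, h.comm, map_mul], by rw [← map_mul, ← map_mul, h.mul_mul_left],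
    by rw [← map_mul, ← map_mul, h.mul_mul_right]⟩

lemma of_map {N : Type*} [Semigroup N] (φ : M →ₙ* N) (hφ : Function.Injective φ)
    (h : IsGroupInverse (φ p) (φ y)) : IsGroupInverse p y :=
  ⟨hφ (by rw [map_mul, h.comm, map_mul]), hφ (by rw [map_mul, map_mul, h.mul_mul_left]),
    hφ (by rw [map_mul, map_mul, h.mul_mul_right])⟩

lemma isAttachedIdempotent {x : M} {n : ℕ+} (h : IsGroupInverse (_root_.semigroupPow x n) y) :
    IsAttachedIdempotent x (_root_.semigroupPow x n * y) :=
  ⟨h.isIdempotentElem, n, h.mem_cornerUnits⟩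

end IsGroupInverse

/-- An element of a semigroup has at most one attached idempotent. -/
lemma IsAttachedIdempotent.unique {x e f : M} (he : IsAttachedIdempotent x e)
    (hf : IsAttachedIdempotent x f) : e = f := by
  obtain ⟨he, m, hm⟩ := he
  obtain ⟨hf, n, hn⟩ := hf
  obtain ⟨y, hy, rfl⟩ := IsGroupInverse.of_cornerUnits he hm
  obtain ⟨z, hz, rfl⟩ := IsGroupInverse.of_cornerUnits hf hn
  -- Raising to the common exponent `m * n` changes neither idempotent, and there the group inverses
  -- agree.
  obtain ⟨h₁, h₁'⟩ := hy.semigroupPow n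
  obtain ⟨h₂, h₂'⟩ := hz.semigroupPow m
  rw [← semigroupPow_mul] at h₁ h₁' h₂ h₂'
  rw [mul_comm] at h₂ h₂'
  rw [← h₁', ← h₂', h₁.unique h₂]

lemma IsAttachedIdempotent.mem_cornerUnits_mul {x e : M} {m : ℕ+} (he : IsIdempotentElem e)
    (hm : semigroupPow x m ∈ cornerUnits e) (n : ℕ+) :
    semigroupPow x (m * n) ∈ cornerUnits e := by
  obtain ⟨y, hy, rfl⟩ := IsGroupInverse.of_cornerUnits he hm
  obtain ⟨h, h'⟩ := hy.semigroupPow n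
  rw [semigroupPow_mul, ← h']
  exact h.mem_cornerUnits

end Semigroup

/-! ### Semigroups with a Zariski-like topology -/

section Topology

open TopologicalSpace Topology Set

/-- A constructible set is a neighbourhood, within its closure, of a dense set of its points. -/
lemma Topology.IsConstructible.exists_isOpen_inter_closure_subset {X : Type*} [TopologicalSpace X]
    {E : Set X} (hE : IsConstructible E) {O : Set X} (hO : IsOpen O) (hOE : (O ∩ E).Nonempty) :
    ∃ W ⊆ O, IsOpen W ∧ W ∩ closure E ⊆ E ∧ (W ∩ E).Nonempty := by
  induction E, hE using BooleanSubalgebra.closure_sdiff_sup_induction generalizing O with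
  | isSublattice =>
    exact ⟨fun s hs t ht ↦ ⟨hs.1.union ht.1, hs.2.union ht.2⟩,
      fun s hs t ht ↦ ⟨hs.1.inter ht.1, hs.2.inter_isOpen ht.2 ht.1⟩⟩
  | bot_mem => exact ⟨isOpen_empty, .empty⟩
  | top_mem => exact ⟨isOpen_univ, .univ⟩
  | sdiff U hU V hV =>
    refine ⟨O ∩ U, inter_subset_left, hO.inter hU.1, ?_, ?_⟩
    · rintro z ⟨⟨-, hzU⟩, hz⟩
      have : closure (U \ V) ⊆ Vᶜ :=
        closure_minimal (fun z hz ↦ hz.2) hV.1.isClosed_compl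
      exact ⟨hzU, this hz⟩
    · obtain ⟨z, hz, hzU, hzV⟩ := hOE
      exact ⟨z, ⟨hz, hzU⟩, hzU, hzV⟩
  | sup s _ t _ hs ht =>
    change (O ∩ (s ∪ t)).Nonempty at hOE
    change ∃ W ⊆ O, IsOpen W ∧ W ∩ closure (s ∪ t) ⊆ s ∪ t ∧ (W ∩ (s ∪ t)).Nonempty
    rw [closure_union]
    -- Either `s` adds nothing to the closure of `t` inside `O`, or `O` can be shrunk away from
    -- `closure t`, leaving only `s`.
    by_cases h : O ∩ s ⊆ closure t
    · have hOs : O ∩ closure s ⊆ closure t :=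
        hO.inter_closure.trans (closure_minimal h isClosed_closure)
      have hOt : (O ∩ t).Nonempty := by
        obtain ⟨z, hz, hzs | hzt⟩ := hOE
        · exact mem_closure_iff.mp (h ⟨hz, hzs⟩) O hO hz
        · exact ⟨z, hz, hzt⟩
      obtain ⟨W, hWO, hW, hWt, z, hz, hzt⟩ := ht hO hOt
      refine ⟨W, hWO, hW, ?_, z, hz, Or.inr hzt⟩
      rintro w ⟨hw, hws | hwt⟩
      · exact Or.inr (hWt ⟨hw, hOs ⟨hWO hw, hws⟩⟩)
      · exact Or.inr (hWt ⟨hw, hwt⟩)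
    · obtain ⟨z, ⟨hzO, hzs⟩, hzt⟩ := not_subset.mp h
      obtain ⟨W, hWO, hW, hWs, y, hy, hys⟩ :=
        hs (hO.inter isClosed_closure.isOpen_compl) ⟨z, ⟨hzO, hzt⟩, hzs⟩
      refine ⟨W, hWO.trans inter_subset_left, hW, ?_, y, hy, Or.inl hys⟩
      rintro w ⟨hw, hws | hwt⟩
      · exact Or.inl (hWs ⟨hw, hws⟩)
      · exact absurd hwt (hWO hw).2

/-- A set which is dense in the closure of a nonempty constructible set meets this set. -/
lemma Topology.IsConstructible.inter_nonempty_of_subset_closure {X : Type*} [TopologicalSpace X]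
    {E A : Set X} (hE : IsConstructible E) (hne : E.Nonempty) (hAE : A ⊆ closure E)
    (hEA : E ⊆ closure A) : (A ∩ E).Nonempty := by
  obtain ⟨W, -, hW, hWE, z, hz, hzE⟩ :=
    hE.exists_isOpen_inter_closure_subset isOpen_univ (by simpa using hne)
  obtain ⟨a, haW, haA⟩ := mem_closure_iff.mp (hEA hzE) W hW hz
  exact ⟨a, haA, hWE ⟨haW, hAE haA⟩⟩

/-- The decreasing sequence of the closures of the tails of a sequence in a Noetherian space is
eventually constant. -/
lemma TopologicalSpace.NoetherianSpace.exists_closure_tail_eq {X : Type*} [TopologicalSpace X]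
    [NoetherianSpace X] (s : ℕ+ → X) :
    ∃ m₀, ∀ m ≥ m₀, closure (s '' Ici m) = closure (s '' Ici m₀) := by
  let T : ℕ+ → Closeds X := fun m ↦ ⟨closure (s '' Ici m), isClosed_closure⟩
  obtain ⟨_, ⟨m₀, rfl⟩, hmin⟩ := (wellFounded_lt (α := Closeds X)).has_min (Set.range T) ⟨_, 1, rfl⟩
  refine ⟨m₀, fun m hm ↦ ?_⟩
  have hle : T m ≤ T m₀ := closure_mono (image_mono (Ici_subset_Ici.mpr hm))
  have := eq_of_le_of_not_lt hle (hmin _ ⟨m, rfl⟩)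
  exact congrArg (fun Z : Closeds X ↦ (Z : Set X)) this

/-- Let `M` be a semigroup with a Noetherian topology for which the translations are continuous and
the conditions `a * w = w * a` and `w * a = w` are closed. Let `P` be the set `M × M`, endowed with
a topology, possibly finer than the product topology, such that the shearing map
`(a, b) ↦ (a, a * b)` is continuous and maps closed sets to constructible sets. Then every element
of `M` has a power with a group inverse. -/
theorem exists_isGroupInverse_semigroupPow {M P : Type*} [Semigroup M] [TopologicalSpace M]
    [NoetherianSpace M] [TopologicalSpace P] (π₁ π₂ : P → M) (pair : M → M → P) (F : P → P)
    (hπ₁ : ∀ a b, π₁ (pair a b) = a) (hπ₂ : ∀ a b, π₂ (pair a b) = b)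
    (hpair : ∀ p, pair (π₁ p) (π₂ p) = p) (hF : ∀ a b, F (pair a b) = pair a (a * b))
    (hπ₂c : Continuous π₂) (hlc : ∀ a, Continuous (pair a)) (hrc : ∀ b, Continuous (pair · b))
    (hFc : Continuous F) (hFim : ∀ Z : Set P, IsClosed Z → IsConstructible (F '' Z))
    (hmul : ∀ a : M, Continuous (a * ·)) (hcomm : ∀ a : M, IsClosed {w : M | a * w = w * a})
    (hfix : ∀ a : M, IsClosed {w : M | w * a = w}) (x : M) :
    ∃ (n : ℕ+) (y : M), IsGroupInverse (semigroupPow x n) y := by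
  obtain ⟨m₀, hm₀⟩ := NoetherianSpace.exists_closure_tail_eq (semigroupPow x)
  set C := closure (semigroupPow x '' Ici m₀) with hC
  have hxC : ∀ n ≥ m₀, semigroupPow x n ∈ C := fun n hn ↦ subset_closure ⟨n, hn, rfl⟩
  let G : Set P := {p | ∃ a ≥ m₀, ∃ b ≥ m₀, p = pair (semigroupPow x a) (semigroupPow x b)}
  -- A point of `A` in the image of `F` gives `x ^ a * z = x ^ b` with `a > b`.
  let A : Set P := {p | ∃ b ≥ m₀, ∃ a > b, p = pair (semigroupPow x a) (semigroupPow x b)}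
  have hAG : A ⊆ G := by
    rintro _ ⟨b, hb, a, hab, rfl⟩
    exact ⟨a, hb.trans hab.le, b, hb, rfl⟩
  -- With `b` fixed, `x ^ a` is a limit of powers with exponent beyond `b`.
  have hGA : closure G ⊆ closure A := by
    refine closure_minimal ?_ isClosed_closure
    rintro _ ⟨a, ha, b, hb, rfl⟩
    have h := hxC a ha
    rw [← hm₀ (m₀ + b) (PNat.lt_add_right m₀ b).le] at h
    refine map_mem_closure (f := (pair · (semigroupPow x b))) (hrc _) h ?_
    rintro _ ⟨n, hn, rfl⟩
    exact ⟨b, hb, n, lt_of_lt_of_le (PNat.lt_add_left b m₀) hn, rfl⟩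
  -- With `a` fixed, `x ^ b` is a limit of powers `x ^ (a + d)`, and `(x ^ a, x ^ (a + d))` is the
  -- image of `(x ^ a, x ^ d)`.
  have hGE : closure G ⊆ closure (F '' closure G) := by
    refine closure_minimal ?_ isClosed_closure
    rintro _ ⟨a, ha, b, hb, rfl⟩
    have h := hxC b hb
    rw [← hm₀ (m₀ + a) (PNat.lt_add_right m₀ a).le] at h
    refine map_mem_closure (hlc (semigroupPow x a)) h ?_
    rintro _ ⟨n, hn, rfl⟩
    obtain ⟨d, hd, rfl⟩ : ∃ d ≥ m₀, n = a + d := by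
      have hn' : (m₀ : ℕ) + a ≤ n := by exact_mod_cast hn
      have hm := m₀.pos
      refine ⟨n - a, ?_, ?_⟩
      · rw [ge_iff_le, ← PNat.coe_le_coe, PNat.sub_coe, if_pos (by rw [← PNat.coe_lt_coe]; omega)]
        omega
      · rw [PNat.add_sub_of_lt]
        rw [← PNat.coe_lt_coe]; omega
    refine ⟨pair (semigroupPow x a) (semigroupPow x d), subset_closure ⟨a, ha, d, hd, rfl⟩, ?_⟩
    rw [hF, semigroupPow_add]
  have hEG : F '' closure G ⊆ closure G := by
    rintro _ ⟨p, hp, rfl⟩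
    refine map_mem_closure hFc hp ?_
    rintro _ ⟨a, ha, b, hb, rfl⟩
    exact ⟨a, ha, a + b, hb.trans (PNat.lt_add_left b a).le, by rw [hF, semigroupPow_add]⟩
  have hne : (F '' closure G).Nonempty :=
    ⟨_, _, subset_closure ⟨m₀, le_rfl, m₀, le_rfl, rfl⟩, rfl⟩
  obtain ⟨_, ⟨b, hb, a, hab, rfl⟩, d, hd, hdF⟩ :=
    (hFim _ isClosed_closure).inter_nonempty_of_subset_closure hne
      ((hAG.trans subset_closure).trans hGE) (hEG.trans hGA)
  have hzC : π₂ d ∈ C := by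
    refine closure_minimal ?_ (isClosed_closure.preimage hπ₂c) hd
    rintro _ ⟨a, ha, b, hb, rfl⟩
    rw [mem_preimage, hπ₂]
    exact hxC b hb
  rw [← hpair d, hF] at hdF
  have hd₁ : π₁ d = semigroupPow x a := by simpa only [hπ₁] using congrArg π₁ hdF
  have hd₂ : semigroupPow x a * π₂ d = semigroupPow x b := by
    simpa only [hπ₂, hd₁] using congrArg π₂ hdF
  clear_value C
  generalize π₂ d = z at hzC hd₂
  obtain ⟨c, rfl⟩ : ∃ c, a = b + c := ⟨a - b, (PNat.add_sub_of_lt hab).symm⟩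
  have hxz : Commute x z := by
    suffices C ⊆ {w | x * w = w * x} from this hzC
    rw [hC]
    refine closure_minimal ?_ (hcomm x)
    rintro _ ⟨n, -, rfl⟩
    exact (Commute.refl x).semigroupPow_right n
  have hqz : Commute (semigroupPow x c) z := (hxz.symm.semigroupPow_right c).symm
  -- As `z` plays the role of `x ^ (-c)`, `f` is the candidate idempotent. It lies in `C` and is a
  -- right identity on `C`, hence `f * f = f`.
  set f := semigroupPow x c * z with hf
  have hfC : f ∈ C := by
    rw [hC] at hzC ⊢
    refine map_mem_closure (hmul (semigroupPow x c)) hzC ?_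
    rintro _ ⟨n, hn, rfl⟩
    exact ⟨c + n, hn.trans (PNat.lt_add_left n c).le, semigroupPow_add x c n⟩
  have hbf : semigroupPow x b * f = semigroupPow x b := by
    rw [hf, ← mul_assoc, ← semigroupPow_add, hd₂]
  have hCf : ∀ w ∈ C, w * f = w := by
    suffices C ⊆ {w | w * f = w} from this
    -- Starting the tail at `b + 1` keeps `n - b` positive.
    rw [← hm₀ (b + 1) (hb.trans (PNat.lt_add_right b 1).le)]
    refine closure_minimal ?_ (hfix f)
    rintro _ ⟨n, hn, rfl⟩
    obtain ⟨e, rfl⟩ : ∃ e, n = e + b := ⟨n - b, (PNat.sub_add_of_lt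
      (lt_of_lt_of_le (PNat.lt_add_right b 1) hn)).symm⟩
    rw [mem_ofPred_eq, semigroupPow_add, mul_assoc, hbf]
  have hff : IsIdempotentElem f := hCf f hfC
  have hpow : semigroupPow (semigroupPow x c) b * semigroupPow z b = f := by
    rw [← hqz.mul_semigroupPow, ← hf, hff.semigroupPow_eq]
  have hfz : f * z = z := by
    rw [hf, hqz.eq, mul_assoc, ← hf, hCf z hzC]
  have hfz' : f * semigroupPow z b = semigroupPow z b := by
    have : Commute f z := by rw [hf]; exact hqz.mul_left (Commute.refl z)
    nth_rw 1 [← hff.semigroupPow_eq b]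
    rw [← this.mul_semigroupPow, hfz]
  have hfx : semigroupPow (semigroupPow x c) b * f = semigroupPow (semigroupPow x c) b := by
    rw [← semigroupPow_mul]
    refine hCf _ (hxC _ (hb.trans ?_))
    rw [← PNat.coe_le_coe, PNat.mul_coe]
    exact Nat.le_mul_of_pos_left _ c.pos
  have hc := hqz.semigroupPow_semigroupPow b b
  -- `x ^ c` itself need not lie in `C`; the exponent `c * b ≥ m₀` ensures that `f` fixes the power.
  refine ⟨c * b, semigroupPow z b, ?_, ?_, ?_⟩ <;> rw [semigroupPow_mul]
  · exact hc
  · rw [mul_assoc, ← hc.eq, hpow, hfx]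
  · rw [← hc.eq, hpow, hfz']

end Topology

/-! ### Rational points of schemes over an algebraically closed field -/

lemma SemigroupObj.comp_mul {C : Type w} [Category.{v} C] [CartesianMonoidalCategory C]
    {T T' S : C} [SemigroupObj S] (f : T' ⟶ T) (a b : T ⟶ S) : f ≫ (a * b) = f ≫ a * f ≫ b := by
  change f ≫ lift a b ≫ mul = lift (f ≫ a) (f ≫ b) ≫ mul
  rw [← Category.assoc, comp_lift]

/-- Composition with a morphism as a homomorphism of semigroups of points. -/
def SemigroupObj.compHom {C : Type w} [Category.{v} C] [CartesianMonoidalCategory C]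
    {T T' : C} (f : T' ⟶ T) (S : C) [SemigroupObj S] : (T ⟶ S) →ₙ* (T' ⟶ S) where
  toFun a := f ≫ a
  map_mul' := comp_mul f

@[simp]
lemma SemigroupObj.compHom_apply {C : Type w} [Category.{v} C] [CartesianMonoidalCategory C]
    {T T' : C} (f : T' ⟶ T) (S : C) [SemigroupObj S] (a : T ⟶ S) : compHom f S a = f ≫ a := rfl

section RatPoints

open TopologicalSpace Topology

variable {k : Type u} [Field k]

/-- The point of the scheme `X` underlying a rational point. -/
noncomputable def RatPoints.pt {X : Over (Spec (.of k))} (p : RatPoints X) : X.left :=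
  p.left (IsLocalRing.closedPoint k)

/-- The Zariski topology on the set of rational points. -/
@[reducible]
noncomputable def RatPoints.zariskiTopology (X : Over (Spec (.of k))) :
    TopologicalSpace (RatPoints X) :=
  .induced RatPoints.pt inferInstance

attribute [local instance] RatPoints.zariskiTopology

lemma RatPoints.pt_comp {X Y : Over (Spec (.of k))} (p : RatPoints X) (f : X ⟶ Y) :
    pt (p ≫ f) = f.left (pt p) := rfl

lemma RatPoints.continuous_comp {X Y : Over (Spec (.of k))} (f : X ⟶ Y) :
    Continuous fun p : RatPoints X ↦ p ≫ f :=
  continuous_induced_rng.mpr (f.left.continuous.comp continuous_induced_dom)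

lemma isNoetherian_of_finiteType (X : Over (Spec (.of k))) [LocallyOfFiniteType X.hom]
    [QuasiCompact X.hom] : IsNoetherian X.left :=
  { LocallyOfFiniteType.isLocallyNoetherian X.hom with
    toCompactSpace := QuasiCompact.compactSpace_of_compactSpace X.hom }

lemma RatPoints.noetherianSpace (X : Over (Spec (.of k))) [LocallyOfFiniteType X.hom]
    [QuasiCompact X.hom] : NoetherianSpace (RatPoints X) :=
  have := isNoetherian_of_finiteType X
  IsInducing.noetherianSpace (i := pt) ⟨rfl⟩

variable [IsAlgClosed k]

lemma RatPoints.pt_injective (X : Over (Spec (.of k))) [LocallyOfFiniteType X.hom] :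
    Function.Injective (pt (X := X)) := fun p q h ↦ by
  ext1
  exact ext_of_apply_closedPoint_eq X.hom (Over.w p) (Over.w q) h

lemma RatPoints.exists_pt_eq {X : Over (Spec (.of k))} [LocallyOfFiniteType X.hom] {x : X.left}
    (hx : IsClosed {x}) : ∃ p : RatPoints X, p.pt = x :=
  ⟨Over.homMk (pointOfClosedPoint X.hom x hx) (pointOfClosedPoint_comp X.hom x hx),
    pointOfClosedPoint_apply X.hom x hx _⟩

lemma RatPoints.isClosed_pt {X : Over (Spec (.of k))} [LocallyOfFiniteType X.hom]
    (p : RatPoints X) : IsClosed {p.pt} :=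
  (pointEquivClosedPoint X.hom ⟨p.left, Over.w p⟩).2

/-- A rational point of `X` whose underlying point is in the image of an injective morphism of
finite type lifts. -/
lemma RatPoints.exists_comp_eq {X V : Over (Spec (.of k))} [LocallyOfFiniteType X.hom]
    (i : V ⟶ X) [LocallyOfFiniteType i.left] (hi : Function.Injective i.left) (p : RatPoints X)
    (hp : p.pt ∈ Set.range i.left) : ∃ q : RatPoints V, q ≫ i = p := by
  obtain ⟨v, hv⟩ := hp
  have : LocallyOfFiniteType V.hom := by rw [← Over.w i]; infer_instance
  have hvc : IsClosed {v} := by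
    have := p.isClosed_pt.preimage i.left.continuous
    rwa [← hv, ← Set.image_singleton, hi.preimage_image] at this
  obtain ⟨q, rfl⟩ := exists_pt_eq hvc
  exact ⟨q, pt_injective X hv⟩

/-- Since `Y` is separated, the equalizer of `f` and `g` is a closed subscheme, and its rational
points are those where `f` and `g` agree. -/
lemma RatPoints.isClosed_comp_eq {X Y : Over (Spec (.of k))} [LocallyOfFiniteType X.hom]
    [IsSeparated Y.hom] (f g : X ⟶ Y) : IsClosed {p : RatPoints X | p ≫ f = p ≫ g} := by
  have h : {p : RatPoints X | p ≫ f = p ≫ g} =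
      pt ⁻¹' Set.range (Limits.equalizer.ι f g).left := by
    ext p
    refine ⟨fun h ↦ ⟨pt (Limits.equalizer.lift p h), ?_⟩, fun h ↦ ?_⟩
    · rw [← pt_comp, Limits.equalizer.lift_ι]
    · obtain ⟨q, rfl⟩ := exists_comp_eq (Limits.equalizer.ι f g)
        (Limits.equalizer.ι f g).left.isClosedEmbedding.injective p h
      change (q ≫ _) ≫ f = (q ≫ _) ≫ g
      rw [Category.assoc, Category.assoc, Limits.equalizer.condition]
  rw [h]
  exact (Limits.equalizer.ι f g).left.isClosedEmbedding.isClosed_range.preimage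
    continuous_induced_dom

/-- Chevalley's theorem for rational points over an algebraically closed field. -/
lemma RatPoints.isConstructible_image_comp {X Y : Over (Spec (.of k))}
    [LocallyOfFiniteType X.hom] [QuasiCompact X.hom] [LocallyOfFiniteType Y.hom]
    [QuasiCompact Y.hom] [IsSeparated Y.hom] (f : X ⟶ Y) {Z : Set (RatPoints X)}
    (hZ : IsClosed Z) : IsConstructible ((fun p ↦ p ≫ f) '' Z) := by
  obtain ⟨D, hD, rfl⟩ := isClosed_induced_iff.mp hZ
  have := isNoetherian_of_finiteType X
  have := isNoetherian_of_finiteType Y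
  have := RatPoints.noetherianSpace Y
  have hw : f.left ≫ Y.hom = X.hom := Over.w f
  have : LocallyOfFiniteType f.left := by
    have : LocallyOfFiniteType (f.left ≫ Y.hom) := by rwa [hw]
    exact locallyOfFiniteType_of_comp f.left Y.hom
  have : QuasiCompact f.left := by
    have : QuasiCompact (f.left ≫ Y.hom) := by rwa [hw]
    exact QuasiCompact.of_comp f.left Y.hom
  have : JacobsonSpace X.left := LocallyOfFiniteType.jacobsonSpace X.hom
  have hDc : IsConstructible D := by
    rw [← isConstructible_compl]
    exact (NoetherianSpace.isCompact Dᶜ).isConstructible hD.isOpen_compl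
  have h : (fun p ↦ p ≫ f) '' (pt ⁻¹' D) = pt (X := Y) ⁻¹' (f.left '' D) := by
    ext q
    constructor
    · rintro ⟨p, hp, rfl⟩
      exact ⟨pt p, hp, rfl⟩
    -- The fibre over a rational point is closed, so by the Jacobson property its nonempty
    -- intersection with `D` contains a closed point, which is rational.
    · rintro ⟨d, hd, hdq⟩
      obtain ⟨z, ⟨hzD, hzq⟩, hzc⟩ := nonempty_inter_closedPoints
        (Z := D ∩ f.left ⁻¹' {pt q}) ⟨d, hd, hdq⟩
        (hD.inter ((isClosed_pt q).preimage f.left.continuous)).isLocallyClosed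
      obtain ⟨p, rfl⟩ := exists_pt_eq hzc
      exact ⟨p, hzD, pt_injective Y hzq⟩
  rw [h]
  refine (f.left.isConstructible_image hDc).preimage continuous_induced_dom fun s _ _ ↦ ?_
  exact fun t _ _ ↦ NoetherianSpace.isCompact _

/-- Every rational point of a semigroup scheme over an algebraically closed field has a power with
a group inverse. -/
theorem RatPoints.exists_isGroupInverse (X : Over (Spec (.of k))) [LocallyOfFiniteType X.hom]
    [QuasiCompact X.hom] [IsSeparated X.hom] [SemigroupObj X] (x : RatPoints X) :
    ∃ (n : ℕ+) (y : RatPoints X), IsGroupInverse (semigroupPow x n) y := by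
  have := RatPoints.noetherianSpace X
  have : LocallyOfFiniteType (X ⊗ X).hom := by rw [Over.tensorObj_hom]; infer_instance
  have : QuasiCompact (X ⊗ X).hom := by rw [Over.tensorObj_hom]; infer_instance
  have : IsSeparated (X ⊗ X).hom := by rw [Over.tensorObj_hom]; infer_instance
  have hconst (a : RatPoints X) (p : RatPoints X) : p ≫ toUnit X ≫ a = a := by
    rw [← Category.assoc, toUnit_unique (p ≫ toUnit X) (𝟙 _), Category.id_comp]
  have hl (a : RatPoints X) (p : RatPoints X) : p ≫ lift (toUnit X ≫ a) (𝟙 X) = lift a p := by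
    rw [comp_lift, hconst, Category.comp_id]
  have hr (a : RatPoints X) (p : RatPoints X) : p ≫ lift (𝟙 X) (toUnit X ≫ a) = lift p a := by
    rw [comp_lift, hconst, Category.comp_id]
  have hml (a p : RatPoints X) : p ≫ lift (toUnit X ≫ a) (𝟙 X) ≫ SemigroupObj.mul = a * p := by
    rw [← Category.assoc, hl]; rfl
  have hmr (a p : RatPoints X) : p ≫ lift (𝟙 X) (toUnit X ≫ a) ≫ SemigroupObj.mul = p * a := by
    rw [← Category.assoc, hr]; rfl
  -- The Zariski topology on the rational points of `X ⊗ X` is in general strictly finer than the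
  -- product topology, whence the separate type `P`.
  refine exists_isGroupInverse_semigroupPow (P := RatPoints (X ⊗ X)) (fun p ↦ p ≫ fst X X)
    (fun p ↦ p ≫ snd X X) (fun a b ↦ lift a b)
    (fun p ↦ p ≫ lift (fst X X) SemigroupObj.mul) (fun a b ↦ lift_fst a b) (fun a b ↦ lift_snd a b)
    (fun p ↦ by rw [lift_comp_fst_snd]) (fun a b ↦ ?_) (continuous_comp _) (fun a ↦ ?_) (fun b ↦ ?_)
    (continuous_comp _) (fun Z hZ ↦ isConstructible_image_comp _ hZ) (fun a ↦ ?_) (fun a ↦ ?_)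
    (fun a ↦ ?_) x
  · rw [comp_lift, lift_fst]; rfl
  · simpa only [hl] using continuous_comp (lift (toUnit X ≫ a) (𝟙 X))
  · simpa only [hr] using continuous_comp (lift (𝟙 X) (toUnit X ≫ b))
  · simpa only [hml] using continuous_comp (lift (toUnit X ≫ a) (𝟙 X) ≫ SemigroupObj.mul)
  · simpa only [hml, hmr] using isClosed_comp_eq (lift (toUnit X ≫ a) (𝟙 X) ≫ SemigroupObj.mul)
      (lift (𝟙 X) (toUnit X ≫ a) ≫ SemigroupObj.mul)
  · simpa only [hmr, Category.comp_id] using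
      isClosed_comp_eq (lift (𝟙 X) (toUnit X ≫ a) ≫ SemigroupObj.mul) (𝟙 X)

end RatPoints

/-! ### Points over arbitrary fields -/

section BaseChange

/-- A right adjoint functor between cartesian monoidal categories maps semigroup objects to
semigroup objects. -/
@[reducible]
def SemigroupObj.ofAdjunction {C : Type*} [Category* C] [CartesianMonoidalCategory C]
    {D : Type*} [Category* D] [CartesianMonoidalCategory D] {F : C ⥤ D} {G : D ⥤ C} (adj : F ⊣ G)
    (S : D) [SemigroupObj S] : SemigroupObj (G.obj S) where
  mul := adj.homEquiv _ _
    ((adj.homEquiv _ _).symm (fst _ _) * (adj.homEquiv _ _).symm (snd _ _))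
  mul_assoc := by
    -- On `T`-points the multiplication is transported from `F.obj T ⟶ S` along the adjunction, so
    -- associativity is inherited.
    have key {T : C} (a b : T ⟶ G.obj S) : lift a b ≫ adj.homEquiv _ _
        ((adj.homEquiv _ _).symm (fst _ _) * (adj.homEquiv _ _).symm (snd _ _)) =
        adj.homEquiv _ _ ((adj.homEquiv _ _).symm a * (adj.homEquiv _ _).symm b) := by
      rw [← adj.homEquiv_naturality_left, comp_mul, ← adj.homEquiv_naturality_left_symm,
        ← adj.homEquiv_naturality_left_symm, lift_fst, lift_snd]
    set μ := adj.homEquiv _ _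
      ((adj.homEquiv _ _).symm (fst (G.obj S) (G.obj S)) *
        (adj.homEquiv _ _).symm (snd (G.obj S) (G.obj S))) with hμ
    have h₁ : μ ▷ G.obj S = lift (lift (fst _ _ ≫ fst _ _) (fst _ _ ≫ snd _ _) ≫ μ) (snd _ _) := by
      ext <;> simp
    have h₂ : (α_ _ _ _).hom ≫ G.obj S ◁ μ =
        lift (fst _ _ ≫ fst _ _) (lift (fst _ _ ≫ snd _ _) (snd _ _) ≫ μ) := by
      ext <;> simp
      rw [← Category.assoc]; congr 1; ext <;> simp
    rw [← Category.assoc, h₁, h₂, key, key, key, key, Equiv.symm_apply_apply,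
      Equiv.symm_apply_apply, _root_.mul_assoc]

lemma SemigroupObj.ofAdjunction_homEquiv_mul {C : Type*} [Category* C] [CartesianMonoidalCategory C]
    {D : Type*} [Category* D] [CartesianMonoidalCategory D] {F : C ⥤ D} {G : D ⥤ C} (adj : F ⊣ G)
    (S : D) [SemigroupObj S] {T : C} (a b : F.obj T ⟶ S) :
    letI := ofAdjunction adj S
    adj.homEquiv _ _ (a * b) = adj.homEquiv _ _ a * adj.homEquiv _ _ b := by
  let := ofAdjunction adj S
  change _ = lift (adj.homEquiv _ _ a) (adj.homEquiv _ _ b) ≫ adj.homEquiv _ _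
    ((adj.homEquiv _ _).symm (fst _ _) * (adj.homEquiv _ _).symm (snd _ _))
  rw [← adj.homEquiv_naturality_left, comp_mul, ← adj.homEquiv_naturality_left_symm,
    ← adj.homEquiv_naturality_left_symm, lift_fst, lift_snd, Equiv.symm_apply_apply,
    Equiv.symm_apply_apply]

variable {k : Type u} [Field k] (S : Over (Spec (.of k))) [LocallyOfFiniteType S.hom]
  [QuasiCompact S.hom] [IsSeparated S.hom] [SemigroupObj S]

/-- Every point of a semigroup scheme over an algebraically closed extension of the base field
has a power with a group inverse. -/
theorem exists_isGroupInverse_of_isAlgClosed {L : Type u} [Field L] [IsAlgClosed L]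
    (f : Spec (.of L) ⟶ Spec (.of k)) (x : Over.mk f ⟶ S) :
    ∃ (n : ℕ+) (y : Over.mk f ⟶ S), IsGroupInverse (semigroupPow x n) y := by
  let adj := Over.mapPullbackAdj f
  let X := (Over.pullback f).obj S
  let : SemigroupObj X := SemigroupObj.ofAdjunction adj S
  have : LocallyOfFiniteType X.hom :=
    inferInstanceAs (LocallyOfFiniteType (Limits.pullback.snd S.hom f))
  have : QuasiCompact X.hom := inferInstanceAs (QuasiCompact (Limits.pullback.snd S.hom f))
  have : IsSeparated X.hom := inferInstanceAs (IsSeparated (Limits.pullback.snd S.hom f))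
  let i : (Over.map f).obj (𝟙_ (Over (Spec (.of L)))) ≅ Over.mk f :=
    Over.isoMk (Iso.refl _) (by simp)
  -- The `L`-valued points of `S` are the rational points of its base change to `L`, compatibly with
  -- products.
  let φ : ((Over.map f).obj (𝟙_ (Over (Spec (.of L)))) ⟶ S) →ₙ* RatPoints X :=
    ⟨adj.homEquiv _ _, SemigroupObj.ofAdjunction_homEquiv_mul adj S⟩
  let ψ : (Over.mk f ⟶ S) →ₙ* RatPoints X := φ.comp (SemigroupObj.compHom i.hom S)
  have hψ : Function.Bijective ψ :=
    (adj.homEquiv _ _).bijective.comp ((Iso.homFromEquiv i).symm.bijective)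
  obtain ⟨n, y, hy⟩ := RatPoints.exists_isGroupInverse X (ψ x)
  obtain ⟨y, rfl⟩ := hψ.2 y
  rw [← map_semigroupPow] at hy
  exact ⟨n, y, hy.of_map ψ hψ.1⟩

/-- Every point of a semigroup scheme over an extension of the base field has a power with a group
inverse. -/
theorem exists_isGroupInverse_of_field {K : Type u} [Field K]
    (g : Spec (.of K) ⟶ Spec (.of k)) (x : Over.mk g ⟶ S) :
    ∃ (n : ℕ+) (y : Over.mk g ⟶ S), IsGroupInverse (semigroupPow x n) y := by
  let π : Spec (.of (AlgebraicClosure K)) ⟶ Spec (.of K) :=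
    Spec.map (CommRingCat.ofHom (algebraMap K (AlgebraicClosure K)))
  have : Flat π := by
    rw [Flat.SpecMap_iff]
    exact (RingHom.flat_algebraMap_iff).mpr inferInstance
  have : Surjective π := ⟨fun y ↦ ⟨IsLocalRing.closedPoint _, Subsingleton.elim _ _⟩⟩
  let π' : Over.mk (π ≫ g) ⟶ Over.mk g := Over.homMk π
  obtain ⟨n, y, hy⟩ := exists_isGroupInverse_of_isAlgClosed S (π ≫ g) (π' ≫ x)
  let T : Over (Spec (.of k)) := Over.mk (Limits.pullback.fst π π ≫ π ≫ g)
  let p₁ : T ⟶ Over.mk (π ≫ g) := Over.homMk (Limits.pullback.fst π π)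
  let p₂ : T ⟶ Over.mk (π ≫ g) := Over.homMk (Limits.pullback.snd π π)
    (by simp [T, ← Limits.pullback.condition_assoc])
  have hp : p₁ ≫ π' = p₂ ≫ π' := by
    ext1
    exact Limits.pullback.condition
  have h₁ := hy.map (SemigroupObj.compHom p₁ S)
  have h₂ := hy.map (SemigroupObj.compHom p₂ S)
  have hpow : semigroupPow (π' ≫ x) n = π' ≫ semigroupPow x n :=
    (map_semigroupPow (SemigroupObj.compHom π' S) x n).symm
  simp only [SemigroupObj.compHom_apply, hpow, ← Category.assoc, hp] at h₁ h₂
  -- Both pullbacks of `y` to the fibre product of `π` with itself are group inverses of the same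
  -- element, so they coincide and `y` descends along `π`.
  have h₁₂ := h₁.unique h₂
  have : IsRegularEpi π := isRegularEpi_of_flat_of_surjective_of_isAffine π
  obtain ⟨u, hu⟩ := IsRegularEpi.exists_of_isKernelPair π (IsPullback.of_hasPullback π π) y.left
    (congrArg (·.left) h₁₂)
  let y' : Over.mk g ⟶ S := Over.homMk u (by
    rw [← cancel_epi π, reassoc_of% hu]
    exact Over.w y)
  have hy' : π' ≫ y' = y := by ext1; exact hu
  have hinj : Function.Injective (SemigroupObj.compHom π' S) := fun a b hab ↦ by
    ext1
    rw [← cancel_epi π]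
    exact congrArg (·.left) hab
  refine ⟨n, y', IsGroupInverse.of_map _ hinj ?_⟩
  rwa [map_semigroupPow, SemigroupObj.compHom_apply, SemigroupObj.compHom_apply, hy']

end BaseChange

/-! ### Spreading out from generic points -/

section SpreadingOut

/-- The closure of a point of a scheme underlies an integral closed subscheme. -/
lemma AlgebraicGeometry.Scheme.exists_isClosedImmersion_range_eq_closure (X : Scheme.{u}) (η : X) :
    ∃ (Z : Scheme.{u}) (i : Z ⟶ X), IsIntegral Z ∧ IsClosedImmersion i ∧
      Set.range i = closure {η} := by
  let f := X.fromSpecResidueField η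
  have hred : IsReduced f.image := by
    have (U : f.ker.subschemeCover.openCover.I₀) :
        IsReduced (f.ker.subschemeCover.openCover.X U) := by
      change X.affineOpens at U
      -- The quotient embeds into the sections over an open subset of the spectrum of a field.
      have h : _root_.IsReduced (Γ(X, U.1) ⧸ f.ker.ideal U) := by
        rw [f.ker_apply U]
        exact isReduced_of_injective _ (RingHom.kerLift_injective (f.app U.1).hom)
      change IsReduced (Spec (.of (Γ(X, U.1) ⧸ f.ker.ideal U)))
      infer_instance
    exact .of_openCover _ f.ker.subschemeCover.openCover
  have hirr : IrreducibleSpace f.image := by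
    rw [irreducibleSpace_def, Set.top_eq_univ, ← f.toImage.denseRange.closure_range,
      ← Set.image_univ]
    exact ((IrreducibleSpace.isIrreducible_univ _).image _
      f.toImage.continuous.continuousOn).closure
  refine ⟨f.image, f.imageι, isIntegral_of_irreducibleSpace_of_isReduced _, inferInstance, ?_⟩
  rw [Scheme.IdealSheafData.range_subschemeι, Scheme.Hom.support_ker,
    Scheme.range_fromSpecResidueField]

/-- The spectrum of the stalk at the generic point is dense in every nonempty open subscheme. -/
lemma AlgebraicGeometry.Scheme.isDominant_fromSpecStalkOfMem_genericPoint {X : Scheme.{u}}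
    [IrreducibleSpace X] (U : X.Opens) (hU : genericPoint X ∈ U) :
    IsDominant (U.fromSpecStalkOfMem (genericPoint X) hU) := by
  refine ⟨dense_iff_inter_open.mpr fun W hW ⟨w, hw⟩ ↦ ?_⟩
  let c := U.fromSpecStalkOfMem (genericPoint X) hU (IsLocalRing.closedPoint _)
  have hc : U.ι c = genericPoint X := by
    change (U.fromSpecStalkOfMem _ hU ≫ U.ι) (IsLocalRing.closedPoint _) = _
    rw [Scheme.Opens.fromSpecStalkOfMem_ι, Scheme.fromSpecStalk_closedPoint]
  have hη : genericPoint X ∈ U.ι '' W :=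
    (genericPoint_spec X).mem_open_set_iff (U.ι.isOpenEmbedding.isOpenMap W hW) |>.mpr
      ⟨U.ι w, trivial, w, hw, rfl⟩
  obtain ⟨w', hw', h⟩ := hη
  obtain rfl : w' = c := U.ι.isOpenEmbedding.injective (h.trans hc.symm)
  exact ⟨c, hw', _, rfl⟩

variable {k : Type u} [Field k] (S : Over (Spec (.of k))) [LocallyOfFiniteType S.hom]
  [QuasiCompact S.hom] [IsSeparated S.hom] [SemigroupObj S]

/-- A point of a semigroup scheme with values in an integral scheme has a power with a group
inverse over a nonempty open subscheme. -/
theorem exists_isGroupInverse_of_isIntegral (T : Over (Spec (.of k))) [IsIntegral T.left]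
    (x : T ⟶ S) :
    ∃ (U : T.left.Opens) (n : ℕ+) (y : Over.mk (U.ι ≫ T.hom) ⟶ S), genericPoint T.left ∈ U ∧
      IsGroupInverse (semigroupPow ((Over.homMk U.ι : Over.mk (U.ι ≫ T.hom) ⟶ T) ≫ x) n) y := by
  let η := genericPoint T.left
  let j : Spec T.left.functionField ⟶ T.left := T.left.fromSpecStalk η
  let j' : Over.mk (j ≫ T.hom) ⟶ T := Over.homMk j
  obtain ⟨n, y, hy⟩ := exists_isGroupInverse_of_field S (K := T.left.functionField)
    (j ≫ T.hom) (j' ≫ x)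
  obtain ⟨U, hU, f, hf, hfS⟩ := spread_out_of_isGermInjective' T.hom S.hom (x := η) y.left
    (Over.w y)
  let i : Over.mk (j ≫ T.hom) ⟶ Over.mk (U.ι ≫ T.hom) :=
    Over.homMk (U.fromSpecStalkOfMem η hU) (by
      simp only [Over.mk_hom]
      exact Scheme.Opens.fromSpecStalkOfMem_ι_assoc U η hU T.hom)
  -- Equations between morphisms from the reduced `U` to the separated `S` can be checked on the
  -- dense generic point.
  have hinj : Function.Injective (SemigroupObj.compHom i S) := fun a b hab ↦ by
    ext1
    have := Scheme.isDominant_fromSpecStalkOfMem_genericPoint U hU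
    have : IsReduced (Over.mk (U.ι ≫ T.hom)).left := inferInstanceAs (IsReduced U.toScheme)
    exact ext_of_isDominant_of_isSeparated S.hom ((Over.w a).trans (Over.w b).symm)
      (U.fromSpecStalkOfMem η hU) (congrArg (·.left) hab)
  refine ⟨U, n, Over.homMk f hfS, hU, IsGroupInverse.of_map _ hinj ?_⟩
  have h₁ : i ≫ Over.homMk U.ι ≫ x = j' ≫ x := by
    rw [← Category.assoc]
    congr 1
    ext1
    exact Scheme.Opens.fromSpecStalkOfMem_ι U η hU
  have h₂ : i ≫ Over.homMk f hfS = y := by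
    ext1
    exact hf.symm
  rwa [map_semigroupPow, SemigroupObj.compHom_apply, SemigroupObj.compHom_apply, h₁, h₂]

end SpreadingOut

/-! ### Stratification -/

section Stratification

open TopologicalSpace Topology

/-- In a Noetherian sober space, a property of subsets which is inherited by relatively open subsets
and which holds on a relatively open neighbourhood of every point in its closure holds on the
strata of a finite partition of any given closed set. -/
theorem TopologicalSpace.NoetherianSpace.exists_finite_partition {X : Type*} [TopologicalSpace X]
    [NoetherianSpace X] [QuasiSober X] (G : Set X → Prop)
    (hG : ∀ A O, G A → IsOpen O → G (A ∩ O))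
    (h : ∀ x, ∃ O, IsOpen O ∧ x ∈ O ∧ G (closure {x} ∩ O)) (Z : Closeds X) :
    ∃ 𝒰 : Set (Set X), 𝒰.Finite ∧ 𝒰.PairwiseDisjoint id ∧ ⋃₀ 𝒰 = Z ∧ ∀ A ∈ 𝒰, G A := by
  induction Z using WellFoundedLT.induction with
  | ind Z ih =>
  by_cases hZ : IsIrreducible (Z : Set X)
  · obtain ⟨x, hx⟩ := QuasiSober.sober hZ Z.isClosed
    obtain ⟨O, hO, hxO, hGO⟩ := h x
    rw [hx.def] at hGO
    have hxZ : x ∈ (Z : Set X) := hx.mem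
    -- One stratum is the neighbourhood `Z ∩ O` of the generic point; the induction handles the
    -- rest.
    let Z' : Closeds X := ⟨Z ∩ Oᶜ, Z.isClosed.inter hO.isClosed_compl⟩
    have hlt : Z' < Z := by
      refine lt_of_le_of_ne (fun z hz ↦ hz.1) fun he ↦ ?_
      rw [← he] at hxZ
      exact hxZ.2 hxO
    obtain ⟨𝒰, hfin, hdis, hun, hGU⟩ := ih Z' hlt
    refine ⟨insert ((Z : Set X) ∩ O) 𝒰, hfin.insert _, ?_, ?_, ?_⟩
    · refine hdis.insert fun A hA _ ↦ ?_
      have hA' : A ⊆ (Z : Set X) ∩ Oᶜ := (Set.subset_sUnion_of_mem hA).trans hun.subset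
      exact Set.disjoint_left.mpr fun z hz hzA ↦ (hA' hzA).2 hz.2
    · rw [Set.sUnion_insert, hun]
      exact Set.inter_union_compl _ _
    · rintro A (rfl | hA)
      exacts [hGO, hGU A hA]
  · rw [IsIrreducible, not_and_or, Set.not_nonempty_iff_eq_empty] at hZ
    rcases hZ with hZ | hZ
    · exact ⟨∅, Set.finite_empty, Set.pairwiseDisjoint_empty, by simp [hZ], by simp⟩
    rw [isPreirreducible_iff_isClosed_union_isClosed] at hZ
    push Not at hZ
    obtain ⟨A, B, hA, hB, hAB, hZA, hZB⟩ := hZ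
    obtain ⟨𝒰, hfin, hdis, hun, hGU⟩ := ih ⟨Z ∩ A, Z.isClosed.inter hA⟩
      (lt_of_le_of_ne (fun z hz ↦ hz.1) fun he ↦ hZA fun z hz ↦ by
        rw [← he] at hz; exact hz.2)
    obtain ⟨𝒱, hfin', hdis', hun', hGV⟩ := ih ⟨Z ∩ B, Z.isClosed.inter hB⟩
      (lt_of_le_of_ne (fun z hz ↦ hz.1) fun he ↦ hZB fun z hz ↦ by
        rw [← he] at hz; exact hz.2)
    -- Cutting the strata of `Z ∩ B` by the open set `Aᶜ` makes them disjoint from those of `Z ∩ A`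
    -- and preserves `G`.
    refine ⟨𝒰 ∪ (· ∩ Aᶜ) '' 𝒱, hfin.union (hfin'.image _), ?_, ?_, ?_⟩
    · refine Set.pairwiseDisjoint_union.mpr ⟨hdis, ?_, ?_⟩
      · rintro _ ⟨V, hV, rfl⟩ _ ⟨W, hW, rfl⟩ hne
        exact (hdis' hV hW fun he ↦ hne (by rw [he])).mono Set.inter_subset_left
          Set.inter_subset_left
      · rintro U hU _ ⟨V, hV, rfl⟩ -
        have hU' : U ⊆ (Z : Set X) ∩ A := (Set.subset_sUnion_of_mem hU).trans hun.subset
        exact Set.disjoint_left.mpr fun z hz hzA ↦ hzA.2 (hU' hz).2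
    · have hun'' : ⋃₀ ((· ∩ Aᶜ) '' 𝒱) = (Z : Set X) ∩ B ∩ Aᶜ := by
        rw [Set.sUnion_image, ← Set.iUnion₂_inter, ← Set.sUnion_eq_biUnion, hun']
        rfl
      rw [Set.sUnion_union, hun, hun'']
      ext z
      have := @hAB z
      simp only [Closeds.coe_mk, Set.mem_union, Set.mem_inter_iff, Set.mem_compl_iff,
        SetLike.mem_coe] at this ⊢
      tauto
    · rintro _ (hU | ⟨V, hV, rfl⟩)
      exacts [hGU _ hU, hG _ _ (hGV V hV) hA.isOpen_compl]

variable {k : Type u} [Field k] {S : Over (Spec (.of k))} [SemigroupObj S]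

/-- On the reduced subscheme with underlying set `A`, the `n`-th power of the tautological point has
a group inverse. -/
def HasGroupInverseOn (n : ℕ+) (A : Set S.left) : Prop :=
  ∃ (V : Over (Spec (.of k))) (i y : V ⟶ S), IsReduced V.left ∧ IsImmersion i.left ∧
    Set.range i.left = A ∧ IsGroupInverse (semigroupPow i n) y

namespace HasGroupInverseOn

lemma isLocallyClosed {n : ℕ+} {A : Set S.left} (h : HasGroupInverseOn n A) :
    IsLocallyClosed A := by
  obtain ⟨V, i, y, -, _, rfl, -⟩ := h
  exact i.left.isLocallyClosed_range

lemma inter_isOpen {n : ℕ+} {A O : Set S.left} (h : HasGroupInverseOn n A) (hO : IsOpen O) :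
    HasGroupInverseOn n (A ∩ O) := by
  obtain ⟨V, i, y, _, _, rfl, h⟩ := h
  let W : V.left.Opens := i.left ⁻¹ᵁ ⟨O, hO⟩
  let j : Over.mk (W.ι ≫ V.hom) ⟶ V := Over.homMk W.ι
  refine ⟨_, j ≫ i, j ≫ y, inferInstanceAs (IsReduced W.toScheme),
    inferInstanceAs (IsImmersion (W.ι ≫ i.left)), ?_, ?_⟩
  · change Set.range (W.ι ≫ i.left) = _
    rw [Scheme.Hom.comp_base, TopCat.coe_comp, Set.range_comp, Scheme.Opens.range_ι]
    exact Set.image_preimage_eq_range_inter.trans rfl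
  · have := h.map (SemigroupObj.compHom j S)
    rwa [map_semigroupPow] at this

/-- The tautological point of the integral closed subscheme on `closure {η}` has a power invertible
over a nonempty open part, which is the trace of an open subset of `S`. -/
lemma exists_closure_inter [LocallyOfFiniteType S.hom] [QuasiCompact S.hom] [IsSeparated S.hom]
    (η : S.left) : ∃ O, IsOpen O ∧ η ∈ O ∧ ∃ n, HasGroupInverseOn n (closure {η} ∩ O) := by
  obtain ⟨Z, i, _, _, hi⟩ := S.left.exists_isClosedImmersion_range_eq_closure η
  let i' : Over.mk (i ≫ S.hom) ⟶ S := Over.homMk i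
  have : IsIntegral (Over.mk (i ≫ S.hom)).left := ‹IsIntegral Z›
  obtain ⟨U, n, y, hU, hy⟩ := exists_isGroupInverse_of_isIntegral S _ i'
  change Z.Opens at U
  obtain ⟨O, hO, hOU⟩ := i.isClosedEmbedding.isInducing.isOpen_iff.mp U.isOpen
  have hη : closure {η} ∩ O = i '' U := by
    rw [← hi, ← Set.image_preimage_eq_range_inter, hOU]
  refine ⟨O, hO, ?_, n, _, _, y, inferInstanceAs (IsReduced U.toScheme),
    inferInstanceAs (IsImmersion (U.ι ≫ i)), ?_, hy⟩
  -- An open set meeting `closure {η}` contains `η`.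
  · have : i (genericPoint Z) ∈ closure {η} ∩ O := by rw [hη]; exact ⟨_, hU, rfl⟩
    obtain ⟨_, hO', rfl⟩ := mem_closure_iff.mp this.1 O hO this.2
    exact hO'
  · change Set.range (U.ι ≫ i) = _
    rw [Scheme.Hom.comp_base, TopCat.coe_comp, Set.range_comp, Scheme.Opens.range_ι, hη]

/-- A rational point in `A` lifts to `V`, and the group inverse over `V` specialises to it with the
same exponent `n`. -/
lemma mem_cornerUnits [IsAlgClosed k] [LocallyOfFiniteType S.hom] {n : ℕ+} {A : Set S.left}
    (h : HasGroupInverseOn n A) {e : RatPoints S → RatPoints S}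
    (he : ∀ x, IsAttachedIdempotent x (e x)) (x : RatPoints S) (hx : x.pt ∈ A) :
    semigroupPow x n ∈ cornerUnits (e x) := by
  obtain ⟨V, i, y, _, _, rfl, h⟩ := h
  obtain ⟨q, rfl⟩ := RatPoints.exists_comp_eq i i.left.isEmbedding.injective x hx
  have hq := h.map (SemigroupObj.compHom q S)
  rw [map_semigroupPow, SemigroupObj.compHom_apply, SemigroupObj.compHom_apply] at hq
  rw [(he _).unique hq.isAttachedIdempotent]
  exact hq.mem_cornerUnits

lemma isMorphismOn {n : ℕ+} {A : Set S.left} (h : HasGroupInverseOn n A)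
    {e : RatPoints S → RatPoints S} (he : ∀ x, IsAttachedIdempotent x (e x)) :
    IsMorphismOn A e := by
  obtain ⟨V, i, y, hV, hi, hA, h⟩ := h
  -- Uniqueness of attached idempotents forces `e` to be given by `i ^ n * y` at every rational
  -- point of `V`.
  refine ⟨V, i, semigroupPow i n * y, hV, hi, hA, fun p ↦ ?_⟩
  have hp := h.map (SemigroupObj.compHom p S)
  rw [map_semigroupPow, SemigroupObj.compHom_apply, SemigroupObj.compHom_apply] at hp
  rw [(he _).unique hp.isAttachedIdempotent, ← SemigroupObj.compHom_apply, map_mul,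
    map_semigroupPow]
  rfl

end HasGroupInverseOn

end Stratification

theorem corollary1 {k : Type u} [Field k] [IsAlgClosed k]
    (S : Over (Spec (.of k))) [LocallyOfFiniteType S.hom] [QuasiCompact S.hom]
    [IsSeparated S.hom] [IsReduced S.left] [SemigroupObj S] :
    ∃ e : RatPoints S → RatPoints S,
      (∀ x, IsAttachedIdempotent x (e x) ∧ ∀ f, IsAttachedIdempotent x f → f = e x) ∧
      (∃ n : ℕ+, ∀ x, semigroupPow x n ∈ cornerUnits (e x)) ∧
      ∃ (m : ℕ) (U : Fin m → Set S.left),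
        (∀ j, IsLocallyClosed (U j)) ∧ (∀ i j, i ≠ j → Disjoint (U i) (U j)) ∧
        (⋃ j, U j) = Set.univ ∧ ∀ j, IsMorphismOn (U j) e := by
  have hex (x : RatPoints S) : ∃ e, IsAttachedIdempotent x e :=
    have ⟨_, _, hy⟩ := RatPoints.exists_isGroupInverse S x
    ⟨_, hy.isAttachedIdempotent⟩
  choose e he using hex
  have := isNoetherian_of_finiteType S
  obtain ⟨𝒰, hfin, hdis, hun, hG⟩ := TopologicalSpace.NoetherianSpace.exists_finite_partition
    (fun A : Set S.left ↦ ∃ n, HasGroupInverseOn n A)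
    (fun A O ⟨n, h⟩ hO ↦ ⟨n, h.inter_isOpen hO⟩) HasGroupInverseOn.exists_closure_inter ⊤
  have := hfin.to_subtype
  obtain ⟨m, ⟨σ⟩⟩ := Finite.exists_equiv_fin 𝒰
  let U : Fin m → Set S.left := fun j ↦ (σ.symm j : Set S.left)
  have hcover : ⋃ j, U j = Set.univ := by
    rw [σ.symm.surjective.iUnion_comp (fun A : 𝒰 ↦ (A : Set S.left)), ← Set.sUnion_eq_iUnion, hun]
    rfl
  choose n hn using fun j ↦ hG (U j) (σ.symm j).2
  refine ⟨e, fun x ↦ ⟨he x, fun f hf ↦ hf.unique (he x)⟩, ⟨∏ j, n j, fun x ↦ ?_⟩, m, U,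
    fun j ↦ (hn j).isLocallyClosed, fun i j hij ↦ ?_, hcover, fun j ↦ (hn j).isMorphismOn he⟩
  · obtain ⟨j, hj⟩ := Set.mem_iUnion.mp (hcover ▸ Set.mem_univ x.pt)
    -- The exponent of each stratum divides the product, and powers of a unit of a corner remain
    -- units there.
    obtain ⟨c, hc⟩ := Finset.dvd_prod_of_mem n (Finset.mem_univ j)
    rw [hc]
    exact IsAttachedIdempotent.mem_cornerUnits_mul (he x).1 ((hn j).mem_cornerUnits he x hj) c
  · exact hdis (σ.symm i).2 (σ.symm j).2 fun h ↦ hij (σ.symm.injective (Subtype.ext h))
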